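/- Let $E/\mathbb{Q}$ be an elliptic curve all of whose points of order $2$ are defined over $\mathbb{Q}$, and let $Q_4 \in E(\overline{\mathbb{Q}})$ be a point of order $4$ such that $\langle Q_4\rangle$ is $\mathbb{Q}$-rational, i.e. $\sigma(\langle Q_4\rangle)=\langle Q_4\rangle$ for all $\sigma\in G_{\mathbb{Q}}=\operatorname{Gal}(\overline{\mathbb{Q}}/\mathbb{Q})$. For an elliptic curve $E'/\mathbb{Q}$ and a basis $\{P,Q\}$ of $E'[n]$, let $\overline{\rho}_{E',n}(\sigma)=\begin{bmatrix} A & C\\ B& D\end{bmatrix}\in \operatorname{GL}(2,\mathbb{Z}/n\mathbb{Z})$, where $\sigma(P)=[A]P+[B]Q$ and $\sigma(Q)=[C]P+[D]Q$. For a $\mathbb{Q}$-rational finite cyclic subgroup $H$ of $E$, write $E/H$ for any elliptic curve over $\mathbb{Q}$ that is the target of an isogeny from $E$, defined over $\mathbb{Q}$, with kernel $H$ (it is unique up to isomorphism over $\mathbb{Q}$). Then there is a basis $\{P_{128},Q_{128}\}$ of $E[128]$ with $[32]Q_{128}=Q_4$ such that, putting $P_2=[64]P_{128}$, the following holds. The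 point $P_2+Q_4$ also has order $4$ and generates a $\mathbb{Q}$-rational subgroup. There are integers $A_i,B_i,C_i,D_i$ ($1\le i\le s$, for some $s$) such that, with respect to this basis, $$\overline{\rho}_{E,128}(G_{\mathbb{Q}})=\left\langle \begin{bmatrix} A_1 & C_1\\ B_1& D_1\end{bmatrix},\ldots,\begin{bmatrix} A_s & C_s\\ B_s& D_s\end{bmatrix}\right\rangle ,$$ and for every such choice of integers, all $A_i$ and $D_i$ are odd, all $B_i$ are even, and all $C_i$ are divisible by $4$. Moreover, for every such choice: 1. $\overline{\rho}_{E/\langle Q_4\rangle,32}(G_{\mathbb{Q}})$ is conjugate in $\operatorname{GL}(2,\mathbb{Z}/32\mathbb{Z})$ to $$\left\langle \begin{bmatrix} A_1 & \frac{C_1}{4}\\ 4B_1& D_1\end{bmatrix},\ldots,\begin{bmatrix} A_s & \frac{C_s}{4}\\ 4B_s& D_s\end{bmatrix}\right\rangle .$$ 2. All $2A_i+C_i-4B_i-2D_i$ are divisible by $4$, and $\overline{\rho}_{E/\langle P_2+Q_4\rangle,32}(G_{\mathbb{Q}})$ is conjugate in $\operatorname{GL}(2,\mathbb{Z}/32\mathbb{Z})$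 to $$\left\langle \begin{bmatrix} A_1-2B_1 & \frac{2A_1+C_1-4B_1-2D_1}{4}\\ 4B_1& 2B_1+D_1\end{bmatrix},\ldots,\begin{bmatrix} A_s-2B_s & \frac{2A_s+C_s-4B_s-2D_s}{4}\\ 4B_s& 2B_s+D_s\end{bmatrix}\right\rangle .$$ -/

import Mathlib

/-!
Mod-`n` Galois representations of elliptic curves over `ℚ`, isogenies over `ℚ`, and subgroups of
`GL(2, ℤ/nℤ)` generated by integer matrices.
-/

noncomputable section

/-- A fixed algebraic closure of `ℚ`. -/
abbrev Qbar : Type := AlgebraicClosure ℚ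

/-- The absolute Galois group of `ℚ`. -/
abbrev GalQ : Type := Qbar ≃ₐ[ℚ] Qbar

/-- Mathlib's group law on the points over a field needs decidable equality of that field. -/
instance Qbar.instDecidableEq : DecidableEq Qbar := Classical.decEq _

namespace WeierstrassCurve

/-- The group `E(ℚ̄)`. -/
abbrev GeomPoint (E : WeierstrassCurve ℚ) : Type := Affine.Point (E.baseChange Qbar)

/-- The action of `σ` on `E(ℚ̄)` through the coordinates. -/
def galAct (E : WeierstrassCurve ℚ) (σ : GalQ) : E.GeomPoint →+ E.GeomPoint :=
  Affine.Point.map (W' := E) σ.toAlgHom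

lemma galAct_one (E : WeierstrassCurve ℚ) (P : E.GeomPoint) : E.galAct 1 P = P := by
  cases P <;> rfl

lemma galAct_mul (E : WeierstrassCurve ℚ) (σ τ : GalQ) (P : E.GeomPoint) :
    E.galAct (σ * τ) P = E.galAct σ (E.galAct τ P) := by
  cases P <;> rfl

/-- The points of `E(ℚ̄)` that come from `E(ℚ)`. -/
def rationalPoints (E : WeierstrassCurve ℚ) : AddSubgroup E.GeomPoint :=
  (Affine.Point.map (W' := E) (Algebra.ofId ℚ Qbar)).range

/-- All points of order dividing two are defined over `ℚ`. -/
def HasFullRationalTwoTorsion (E : WeierstrassCurve ℚ) : Prop :=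
  ∀ P : E.GeomPoint, 2 • P = 0 → P ∈ E.rationalPoints

/-- A subgroup `H` of `E(ℚ̄)` is `ℚ`-rational if `σ(H) = H` for all `σ`; its points need not be
fixed by `σ`. -/
def IsRationalSubgroup (E : WeierstrassCurve ℚ) (H : AddSubgroup E.GeomPoint) : Prop :=
  ∀ σ : GalQ, H.map (E.galAct σ) = H

/-- The group `E[n]` of points of `E(ℚ̄)` of order dividing `n`. -/
abbrev nTorsion (E : WeierstrassCurve ℚ) (n : ℕ) : AddSubgroup E.GeomPoint :=
  AddSubgroup.torsionBy E.GeomPoint (n : ℤ)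

instance instModuleNTorsion (E : WeierstrassCurve ℚ) (n : ℕ) : Module (ZMod n) (E.nTorsion n) :=
  AddSubgroup.torsionBy.zmodModule

lemma galAct_mem_nTorsion (E : WeierstrassCurve ℚ) (n : ℕ) (σ : GalQ) {P : E.GeomPoint}
    (hP : P ∈ E.nTorsion n) : E.galAct σ P ∈ E.nTorsion n := by
  rw [AddSubgroup.torsionBy.nsmul_iff] at hP ⊢
  rw [← map_nsmul, hP, map_zero]

/-- The action of the Galois group on `E[n]` by `ℤ/nℤ`-linear maps. -/
def galRep (E : WeierstrassCurve ℚ) (n : ℕ) : GalQ →* Module.End (ZMod n) (E.nTorsion n) where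
  toFun σ := AddMonoidHom.toZModLinearMap n
    (((E.galAct σ).comp (E.nTorsion n).subtype).codRestrict (E.nTorsion n)
      fun P => E.galAct_mem_nTorsion n σ P.2)
  map_one' := by
    refine LinearMap.ext fun P => Subtype.ext ?_
    exact E.galAct_one P
  map_mul' σ τ := by
    refine LinearMap.ext fun P => Subtype.ext ?_
    exact E.galAct_mul σ τ P

/-- The mod-`n` Galois representation in coordinates: if `b = {P, Q}`, `σ(P) = A P + B Q` and
`σ(Q) = C P + D Q`, then `σ` is sent to the matrix with rows `(A, C)` and `(B, D)`. -/
def modRep (E : WeierstrassCurve ℚ) {n : ℕ} (b : Module.Basis (Fin 2) (ZMod n) (E.nTorsion n)) :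
    GalQ →* GL (Fin 2) (ZMod n) :=
  (Units.map (LinearMap.toMatrixAlgEquiv b : _ →* Matrix (Fin 2) (Fin 2) (ZMod n))).comp
    (E.galRep n).toHomUnits

/-- The image of the mod-`n` Galois representation with respect to a basis of `E[n]`. -/
def modImage (E : WeierstrassCurve ℚ) {n : ℕ}
    (b : Module.Basis (Fin 2) (ZMod n) (E.nTorsion n)) : Subgroup (GL (Fin 2) (ZMod n)) :=
  (E.modRep b).range

/-- Projective coordinates `[x : y : 1]` or `[0 : 1 : 0]` of a point. -/
def GeomPoint.coords {E : WeierstrassCurve ℚ} : E.GeomPoint → Fin 3 → Qbar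
  | .zero => ![0, 1, 0]
  | .some x y _ => ![x, y, 1]

/-- A map `E(ℚ̄) → E'(ℚ̄)` is a morphism of projective curves defined over `ℚ`: around each point it
is given by three homogeneous polynomials of the same degree with rational coefficients. -/
def IsMorphismOverQ {E E' : WeierstrassCurve ℚ} (f : E.GeomPoint → E'.GeomPoint) : Prop :=
  ∀ P : E.GeomPoint, ∃ (d : ℕ) (F : Fin 3 → MvPolynomial (Fin 3) ℚ),
    (∀ i, (F i).IsHomogeneous d) ∧
    (∃ i, MvPolynomial.aeval P.coords (F i) ≠ 0) ∧
    ∀ R : E.GeomPoint, (∃ i, MvPolynomial.aeval R.coords (F i) ≠ 0) →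
      ∃ u : Qbar, u ≠ 0 ∧ ∀ i, MvPolynomial.aeval R.coords (F i) = u * (f R).coords i

/-- An isogeny defined over `ℚ`: a nonzero homomorphism of algebraic groups over `ℚ`. -/
structure RatIsogeny (E E' : WeierstrassCurve ℚ) where
  toHom : E.GeomPoint →+ E'.GeomPoint
  isMorphism : IsMorphismOverQ toHom
  ne_zero : toHom ≠ 0

end WeierstrassCurve

/-- The integer matrices `M i` are invertible modulo `n`, and their reductions modulo `n` generate
the subgroup `H` of `GL(2, ℤ/nℤ)`. -/
def IsGeneratedByMod {s : ℕ} (n : ℕ) (M : Fin s → Matrix (Fin 2) (Fin 2) ℤ)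
    (H : Subgroup (GL (Fin 2) (ZMod n))) : Prop :=
  ∃ g : Fin s → GL (Fin 2) (ZMod n),
    (∀ i, (g i : Matrix (Fin 2) (Fin 2) (ZMod n)) = (M i).map (Int.cast : ℤ → ZMod n)) ∧
    H = Subgroup.closure (Set.range g)

/-- `E[n]` has a basis and, for each basis, the image of the mod-`n` Galois representation of `E` is
conjugate in `GL(2, ℤ/nℤ)` to the subgroup generated by the reductions of the matrices `M i`. -/
def WeierstrassCurve.ModImageConjTo (E : WeierstrassCurve ℚ) {s : ℕ} (n : ℕ)
    (M : Fin s → Matrix (Fin 2) (Fin 2) ℤ) : Prop :=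
  Nonempty (Module.Basis (Fin 2) (ZMod n) (E.nTorsion n)) ∧
  ∀ b : Module.Basis (Fin 2) (ZMod n) (E.nTorsion n),
    ∃ (H : Subgroup (GL (Fin 2) (ZMod n))) (g : GL (Fin 2) (ZMod n)),
      IsGeneratedByMod n M H ∧ H.map (MulAut.conj g).toMonoidHom = E.modImage b

end

/-! Choose Q with 32Q = Q₄ and P with 64P a point of order two other than 2Q₄; then {P, Q} is a
basis of E[128]. Both kernels have the form ⟨32(cP + Q)⟩: c = 0 gives Q₄, and c = 2 gives 64P + Q₄.
If φ is an isogeny over ℚ with this kernel, then φ(4P) and φ(cP + Q) form a basis of E'[32]. Since φ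
commutes with Galois, the matrix of σ in that basis comes from rewriting σ(4P) and σ(cP + Q) in
terms of 4P and cP + Q (`RatIsogeny.map_galAct`, `RatIsogeny.modImageConjTo`). The action of σ on
E[128] thus determines its action on E'[32], so generators are carried to generators.

The upper right entry needs a division by 4. Rational two-torsion makes A, D odd and B even,
stability of ⟨Q₄⟩ gives 4 ∣ C, and 2A − 2D is then divisible by 4 (`dvd_of_galAct_eq`).

Bases are recognised from two facts over ℚ̄: there are exactly four points killed by 2, and every
point can be halved. By induction, P and Q form a basis of the 2^(k+1)-torsion once 2^k P and 2^k Q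
are distinct points of order two. Applied to E' as well, this criterion avoids any use of
surjectivity of φ. -/

noncomputable section

/-! ### Points of order two and halving of points, by explicit formulas -/

namespace WeierstrassCurve.Affine

variable {F : Type*} [Field F] {W : WeierstrassCurve.Affine F}

/-- The abscissae of the points of order two: the completed square of the Weierstrass equation
is `4 (x - e₁) (x - e₂) (x - e₃)`. -/
structure TwoDivisionRoots (W : WeierstrassCurve.Affine F) (e₁ e₂ e₃ : F) : Prop where
  ne₁₂ : e₁ ≠ e₂
  ne₁₃ : e₁ ≠ e₃
  ne₂₃ : e₂ ≠ e₃
  b₂_eq : W.b₂ = -4 * (e₁ + e₂ + e₃)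
  b₄_eq : 2 * W.b₄ = 4 * (e₁ * e₂ + e₁ * e₃ + e₂ * e₃)
  b₆_eq : W.b₆ = -4 * (e₁ * e₂ * e₃)

/-- The two-torsion cubic splits over F, and its discriminant is nonzero because W is elliptic, so
its roots are distinct. -/
lemma exists_twoDivisionRoots [CharZero F] [IsAlgClosed F] (W : WeierstrassCurve.Affine F)
    [W.IsElliptic] : ∃ e₁ e₂ e₃ : F, TwoDivisionRoots W e₁ e₂ e₃ := by
  have ha : W.twoTorsionPolynomial.a ≠ 0 := by simp [twoTorsionPolynomial]
  obtain ⟨x, y, z, h3⟩ := (Cubic.splits_iff_roots_eq_three (φ := RingHom.id F) ha).mp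
    (IsAlgClosed.splits _)
  have hd := W.twoTorsionPolynomial_discr_ne_zero_of_isElliptic (isUnit_iff_ne_zero.mpr two_ne_zero)
  obtain ⟨h12, h13, h23⟩ := (Cubic.discr_ne_zero_iff_roots_ne ha h3).mp hd
  have hb := Cubic.b_eq_three_roots ha h3
  have hc := Cubic.c_eq_three_roots ha h3
  have hd := Cubic.d_eq_three_roots ha h3
  simp only [twoTorsionPolynomial, RingHom.id_apply] at hb hc hd
  exact ⟨x, y, z, h12, h13, h23, by rw [hb]; ring, hc, by rw [hd]; ring⟩

namespace TwoDivisionRoots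

variable {e₁ e₂ e₃ : F}

lemma rotate (h : TwoDivisionRoots W e₁ e₂ e₃) : TwoDivisionRoots W e₂ e₃ e₁ :=
  ⟨h.ne₂₃, h.ne₁₂.symm, h.ne₁₃.symm, by rw [h.b₂_eq]; ring, by rw [h.b₄_eq]; ring,
    by rw [h.b₆_eq]; ring⟩

lemma sq_eq (h : TwoDivisionRoots W e₁ e₂ e₃) {x y : F} (hxy : W.Equation x y) :
    (2 * y + W.a₁ * x + W.a₃) ^ 2 = 4 * ((x - e₁) * (x - e₂) * (x - e₃)) := by
  have h2 := h.b₂_eq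
  have h4 := h.b₄_eq
  have h6 := h.b₆_eq
  rw [b₂] at h2
  rw [b₄] at h4
  rw [b₆] at h6
  rw [equation_iff] at hxy
  linear_combination 4 * hxy + x ^ 2 * h2 + x * h4 + h6

variable [CharZero F]

lemma equation_of_sq_eq (h : TwoDivisionRoots W e₁ e₂ e₃) {x y : F}
    (hxy : (2 * y + W.a₁ * x + W.a₃) ^ 2 = 4 * ((x - e₁) * (x - e₂) * (x - e₃))) :
    W.Equation x y := by
  have h2 := h.b₂_eq
  have h4 := h.b₄_eq
  have h6 := h.b₆_eq
  rw [b₂] at h2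
  rw [b₄] at h4
  rw [b₆] at h6
  rw [equation_iff]
  linear_combination (1 / 4) * (hxy - x ^ 2 * h2 - x * h4 - h6)

variable [W.IsElliptic]

lemma nonsingular (h : TwoDivisionRoots W e₁ e₂ e₃) :
    W.Nonsingular e₁ (-(W.a₁ * e₁ + W.a₃) / 2) :=
  equation_iff_nonsingular.mp <| h.equation_of_sq_eq <| by ring

/-- The point of order two with abscissa `e₁`. -/
def point (h : TwoDivisionRoots W e₁ e₂ e₃) : W.Point :=
  .some _ _ h.nonsingular

lemma point_ne_point {f₁ f₂ f₃ : F} (h : TwoDivisionRoots W e₁ e₂ e₃)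
    (h' : TwoDivisionRoots W f₁ f₂ f₃) (hef : e₁ ≠ f₁) : h.point ≠ h'.point := by
  intro H
  simp only [point, Point.some.injEq] at H
  exact hef H.1

end TwoDivisionRoots

variable [DecidableEq F]

lemma Point.two_nsmul_some_eq_zero_iff {x y : F} (hxy : W.Nonsingular x y) :
    2 • Point.some x y hxy = 0 ↔ 2 * y + W.a₁ * x + W.a₃ = 0 := by
  rw [two_nsmul, add_eq_zero_iff_eq_neg, Point.neg_some]
  simp only [Point.some.injEq, true_and, negY]
  constructor <;> intro H <;> linear_combination H

lemma TwoDivisionRoots.two_nsmul_eq_zero_iff [CharZero F] [W.IsElliptic] {e₁ e₂ e₃ : F}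
    (h : TwoDivisionRoots W e₁ e₂ e₃) (P : W.Point) :
    2 • P = 0 ↔ P = 0 ∨ P = h.point ∨ P = h.rotate.point ∨ P = h.rotate.rotate.point := by
  match P with
  | 0 => simp
  | .some x y hxy =>
    rw [Point.two_nsmul_some_eq_zero_iff]
    simp only [Point.some_ne_zero, false_or, TwoDivisionRoots.point, Point.some.injEq]
    constructor
    · intro H
      have H' := h.sq_eq hxy.left
      have hy : y = -(W.a₁ * x + W.a₃) / 2 := by
        rw [eq_div_iff two_ne_zero]; linear_combination H
      rw [H] at H'
      have : (x - e₁) * (x - e₂) * (x - e₃) = 0 := by linear_combination -(1 / 4) * H'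
      rcases mul_eq_zero.mp this with h1 | h1
      · rcases mul_eq_zero.mp h1 with h1 | h1
        · obtain rfl := sub_eq_zero.mp h1; exact .inl ⟨rfl, hy⟩
        · obtain rfl := sub_eq_zero.mp h1; exact .inr <| .inl ⟨rfl, hy⟩
      · obtain rfl := sub_eq_zero.mp h1; exact .inr <| .inr ⟨rfl, hy⟩
    · rintro (⟨rfl, rfl⟩ | ⟨rfl, rfl⟩ | ⟨rfl, rfl⟩) <;> ring

/-- An elliptic curve over an algebraically closed field of characteristic zero has exactly four
points of order dividing two. -/
theorem Point.ncard_two_torsion [CharZero F] [IsAlgClosed F] [W.IsElliptic] :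
    {P : W.Point | 2 • P = 0}.ncard = 4 := by
  obtain ⟨e₁, e₂, e₃, h⟩ := exists_twoDivisionRoots W
  have : {P : W.Point | 2 • P = 0} =
      {0, h.point, h.rotate.point, h.rotate.rotate.point} := by
    ext P
    simpa using h.two_nsmul_eq_zero_iff P
  rw [this]
  have n1 := h.point_ne_point h.rotate h.ne₁₂
  have n2 := h.point_ne_point h.rotate.rotate h.ne₁₃
  have n3 := h.rotate.point_ne_point h.rotate.rotate h.ne₂₃
  have z1 : 0 ≠ h.point := (Point.some_ne_zero _).symm
  have z2 : 0 ≠ h.rotate.point := (Point.some_ne_zero _).symm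
  have z3 : 0 ≠ h.rotate.rotate.point := (Point.some_ne_zero _).symm
  rw [Set.ncard_eq_toFinset_card']
  simp [*]

/-- Halving a point whose abscissa differs from each `eᵢ` by a square. -/
lemma TwoDivisionRoots.exists_two_nsmul_eq [CharZero F] [W.IsElliptic] {e₁ e₂ e₃ : F}
    (h : TwoDivisionRoots W e₁ e₂ e₃) {x y : F} (hxy : W.Nonsingular x y) {r₁ r₂ r₃ : F}
    (h₁ : r₁ ^ 2 = x - e₁) (h₂ : r₂ ^ 2 = x - e₂) (h₃ : r₃ ^ 2 = x - e₃)
    (hr : 2 * (r₁ * r₂ * r₃) = 2 * y + W.a₁ * x + W.a₃) :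
    ∃ P : W.Point, 2 • P = .some x y hxy := by
  have n12 : r₁ + r₂ ≠ 0 := fun H => h.ne₁₂ <| by
    linear_combination h₁ - h₂ - (r₁ - r₂) * H
  have n13 : r₁ + r₃ ≠ 0 := fun H => h.ne₁₃ <| by
    linear_combination h₁ - h₃ - (r₁ - r₃) * H
  have n23 : r₂ + r₃ ≠ 0 := fun H => h.ne₂₃ <| by
    linear_combination h₂ - h₃ - (r₂ - r₃) * H
  obtain rfl : e₁ = x - r₁ ^ 2 := by rw [h₁]; ring
  obtain rfl : e₂ = x - r₂ ^ 2 := by rw [h₂]; ring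
  obtain rfl : e₃ = x - r₃ ^ 2 := by rw [h₃]; ring
  -- The abscissa u of the half satisfies u − e₁ = (r₁ + r₂)(r₁ + r₃), and similarly for e₂, e₃.
  -- Hence ∏ (u − eᵢ) = v², and w solves 2w + a₁u + a₃ = 2v.
  obtain ⟨u, hu⟩ : ∃ u, u = x + r₁ * r₂ + r₁ * r₃ + r₂ * r₃ := ⟨_, rfl⟩
  obtain ⟨v, hv⟩ : ∃ v, v = (r₁ + r₂) * (r₁ + r₃) * (r₂ + r₃) := ⟨_, rfl⟩
  obtain ⟨w, hw⟩ : ∃ w, w = v - (W.a₁ * u + W.a₃) / 2 := ⟨_, rfl⟩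
  have hv0 : v ≠ 0 := hv ▸ mul_ne_zero (mul_ne_zero n12 n13) n23
  have hns : W.Nonsingular u w := equation_iff_nonsingular.mp <| h.equation_of_sq_eq <| by
    rw [hw, hv, hu]; ring
  have hsub : w - W.negY u w = 2 * v := by rw [negY, hw]; ring
  have hne : w ≠ W.negY u w := fun H => by
    rw [sub_eq_zero.mpr H] at hsub
    exact hv0 (by simpa using hsub.symm)
  have h2 := h.b₂_eq
  have h4 := h.b₄_eq
  rw [b₂] at h2
  rw [b₄] at h4
  have hslope : W.slope u u w w = r₁ + r₂ + r₃ - W.a₁ / 2 := by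
    rw [slope_of_Y_ne rfl hne, hsub, div_eq_iff (mul_ne_zero two_ne_zero hv0)]
    have : 3 * u ^ 2 + 2 * W.a₂ * u + W.a₄ - W.a₁ * w =
      3 * u ^ 2 - 2 * (x - r₁ ^ 2 + (x - r₂ ^ 2) + (x - r₃ ^ 2)) * u +
      ((x - r₁ ^ 2) * (x - r₂ ^ 2) + (x - r₁ ^ 2) * (x - r₃ ^ 2) + (x - r₂ ^ 2) * (x - r₃ ^ 2))
      - W.a₁ * v := by
      rw [hw]
      linear_combination (1 / 2) * u * h2 + (1 / 4) * h4
    rw [this, hu, hv]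
    ring
  refine ⟨.some u w hns, ?_⟩
  rw [two_nsmul, Point.add_self_of_Y_ne hne]
  have hX : W.addX u u (W.slope u u w w) = x := by
    rw [addX, hslope, hu]
    linear_combination -(1 / 4) * h2
  simp only [Point.some.injEq]
  refine ⟨hX, ?_⟩
  rw [addY, negAddY, hX, negY, hslope, hw, hv, hu]
  linear_combination (1 / 2) * hr

/-- Doubling is surjective on the points over an algebraically closed field of characteristic
zero. -/
theorem Point.exists_two_nsmul_eq [CharZero F] [IsAlgClosed F] [W.IsElliptic] (T : W.Point) :
    ∃ P : W.Point, 2 • P = T := by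
  match T with
  | 0 => exact ⟨0, by simp⟩
  | .some x y hxy =>
    obtain ⟨e₁, e₂, e₃, h⟩ := exists_twoDivisionRoots W
    obtain ⟨r₁, h₁⟩ := IsAlgClosed.exists_pow_nat_eq (x - e₁) two_pos
    obtain ⟨r₂, h₂⟩ := IsAlgClosed.exists_pow_nat_eq (x - e₂) two_pos
    obtain ⟨r₃, h₃⟩ := IsAlgClosed.exists_pow_nat_eq (x - e₃) two_pos
    -- The roots fix y only up to sign; flipping one of them corrects the sign.
    have hsq : (2 * (r₁ * r₂ * r₃)) ^ 2 = (2 * y + W.a₁ * x + W.a₃) ^ 2 := by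
      rw [h.sq_eq hxy.left, ← h₁, ← h₂, ← h₃]; ring
    rcases sq_eq_sq_iff_eq_or_eq_neg.mp hsq with hr | hr
    · exact h.exists_two_nsmul_eq hxy h₁ h₂ h₃ hr
    · exact h.exists_two_nsmul_eq hxy h₁ h₂ (r₃ := -r₃) (by rw [neg_sq, h₃])
        (by linear_combination -hr)

end WeierstrassCurve.Affine

end

/-! Two-power torsion of an abelian group with four points of order dividing two -/

section TwoPowerTorsion

variable {A : Type*} [AddCommGroup A]

lemma two_torsion_eq_of_ncard {T S : A} (hc : {R : A | 2 • R = 0}.ncard = 4)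
    (hT : 2 • T = 0) (hS : 2 • S = 0) (hT0 : T ≠ 0) (hS0 : S ≠ 0) (hTS : T ≠ S)
    {R : A} (hR : 2 • R = 0) : R = 0 ∨ R = T ∨ R = S ∨ R = T + S := by
  classical
  have hTS0 : T + S ≠ 0 := fun h => hTS <| by
    rw [eq_neg_of_add_eq_zero_left h, neg_eq_iff_add_eq_zero, ← two_nsmul, hS]
  have hsub : (({0, T, S, T + S} : Finset A) : Set A) ⊆ {R : A | 2 • R = 0} := by
    intro x hx
    simp only [Finset.coe_insert, Finset.coe_singleton, Set.mem_insert_iff,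
      Set.mem_singleton_iff] at hx
    rcases hx with rfl | rfl | rfl | rfl <;> simp [hT, hS, smul_add]
  have hcard : ({0, T, S, T + S} : Finset A).card = 4 := by
    simp [hT0.symm, hS0.symm, hTS, hTS0.symm, hT0, hS0]
  have heq := Set.eq_of_subset_of_ncard_le hsub (by rw [hc, Set.ncard_coe_finset, hcard])
    (Set.finite_of_ncard_pos (by omega))
  have hR' : R ∈ {R : A | 2 • R = 0} := hR
  rw [← heq] at hR'
  simpa using hR'

lemma exists_pow_two_nsmul_eq (hd : ∀ T : A, ∃ P, 2 • P = T) (k : ℕ) (T : A) :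
    ∃ P, 2 ^ k • P = T := by
  induction k generalizing T with
  | zero => exact ⟨T, by simp⟩
  | succ k ih =>
    obtain ⟨P, rfl⟩ := ih T
    obtain ⟨R, rfl⟩ := hd P
    exact ⟨R, by rw [pow_succ, mul_nsmul']⟩

lemma zsmul_eq_zero_or_of_two_nsmul {T : A} (hT : 2 • T = 0) (a : ℤ) :
    (Even a ∧ a • T = 0) ∨ (Odd a ∧ a • T = T) := by
  have h2 : (2 : ℤ) • T = 0 := by rw [← hT]; exact ofNat_zsmul T 2
  rcases Int.even_or_odd' a with ⟨c, rfl | rfl⟩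
  · exact .inl ⟨even_two_mul c, by rw [mul_comm, mul_zsmul, h2, zsmul_zero]⟩
  · exact .inr ⟨odd_two_mul_add_one c, by
      rw [add_zsmul, mul_comm, mul_zsmul, h2, zsmul_zero, zero_add, one_zsmul]⟩

/-- The two-torsion points `T` and `S` are nonzero and distinct. -/
structure IndepTwoTorsion (T S : A) : Prop where
  left : 2 • T = 0
  right : 2 • S = 0
  left_ne : T ≠ 0
  right_ne : S ≠ 0
  ne : T ≠ S

lemma IndepTwoTorsion.even_even {T S : A} (h : IndepTwoTorsion T S) {a b : ℤ}
    (hab : a • T + b • S = 0) : Even a ∧ Even b := by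
  rcases zsmul_eq_zero_or_of_two_nsmul h.left a with ⟨ha, ha'⟩ | ⟨ha, ha'⟩ <;>
  rcases zsmul_eq_zero_or_of_two_nsmul h.right b with ⟨hb, hb'⟩ | ⟨hb, hb'⟩ <;>
  rw [ha', hb'] at hab
  · exact ⟨ha, hb⟩
  · exact absurd (by simpa using hab) h.right_ne
  · exact absurd (by simpa using hab) h.left_ne
  · refine absurd ?_ h.ne
    rw [eq_neg_of_add_eq_zero_left hab, neg_eq_iff_add_eq_zero, ← two_nsmul, h.right]

/-- Multiplying a relation by the top power of two shows that both coefficients are even; the halved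
coefficients give a relation between 2P and 2Q, to which induction applies. -/
lemma IndepTwoTorsion.dvd_of_zsmul_add_zsmul_eq_zero {k : ℕ} {P Q : A}
    (h : IndepTwoTorsion (2 ^ k • P) (2 ^ k • Q)) {a b : ℤ} (hab : a • P + b • Q = 0) :
    (2 ^ (k + 1) : ℤ) ∣ a ∧ (2 ^ (k + 1) : ℤ) ∣ b := by
  induction k generalizing P Q a b with
  | zero =>
    obtain ⟨ha, hb⟩ := h.even_even (a := a) (b := b) (by simpa using hab)
    exact ⟨by simpa using ha.two_dvd, by simpa using hb.two_dvd⟩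
  | succ k ih =>
    have h0 : a • (2 ^ (k + 1) • P) + b • (2 ^ (k + 1) • Q) = 0 := by
      rw [smul_comm a, smul_comm b, ← smul_add, hab, smul_zero]
    obtain ⟨⟨a, rfl⟩, ⟨b, rfl⟩⟩ := h.even_even h0
    rw [pow_succ, mul_nsmul', mul_nsmul'] at h
    obtain ⟨⟨c, rfl⟩, ⟨d, rfl⟩⟩ := ih h (a := a) (b := b) (by
      rw [← hab, two_nsmul, two_nsmul, zsmul_add, zsmul_add, add_zsmul, add_zsmul])
    exact ⟨⟨c, by ring⟩, ⟨d, by ring⟩⟩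

/-- A multiple of R is killed by 2, which determines a and b modulo 2. Then R − aP − bQ has smaller
exponent and, by induction, is a combination of 2P and 2Q. -/
lemma IndepTwoTorsion.exists_zsmul_add_zsmul_eq (hc : {R : A | 2 • R = 0}.ncard = 4) {k : ℕ}
    {P Q : A} (h : IndepTwoTorsion (2 ^ k • P) (2 ^ k • Q)) {R : A} (hR : 2 ^ (k + 1) • R = 0) :
    ∃ a b : ℤ, R = a • P + b • Q := by
  have key : ∀ (T S R : A), IndepTwoTorsion T S → 2 • R = 0 →
      ∃ a b : ℤ, R = a • T + b • S := by
    intro T S R h hR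
    rcases two_torsion_eq_of_ncard hc h.left h.right h.left_ne h.right_ne h.ne hR with
      rfl | rfl | rfl | rfl
    · exact ⟨0, 0, by simp⟩
    · exact ⟨1, 0, by simp⟩
    · exact ⟨0, 1, by simp⟩
    · exact ⟨1, 1, by simp⟩
  induction k generalizing P Q R with
  | zero =>
    obtain ⟨a, b, hab⟩ := key _ _ R h (by simpa using hR)
    exact ⟨a, b, by simpa using hab⟩
  | succ k ih =>
    obtain ⟨a, b, hab⟩ := key _ _ (2 ^ (k + 1) • R) h (by rw [← mul_nsmul, ← pow_succ, hR])
    have h' := h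
    rw [pow_succ, mul_nsmul', mul_nsmul'] at h'
    obtain ⟨c, d, hcd⟩ := ih (R := R - (a • P + b • Q)) h' (by
      rw [smul_sub, hab, smul_add, smul_comm a, smul_comm b, sub_self])
    refine ⟨a + 2 * c, b + 2 * d, ?_⟩
    rw [sub_eq_iff_eq_add] at hcd
    rw [hcd, two_nsmul, two_nsmul, add_zsmul, add_zsmul, two_mul, two_mul, add_zsmul, add_zsmul,
      zsmul_add, zsmul_add]
    abel

end TwoPowerTorsion

noncomputable section

/-! Galois action, isogenies, and the matrices of the mod-`n` representation -/

namespace WeierstrassCurve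

variable {E E' : WeierstrassCurve ℚ}

lemma GeomPoint.coords_galAct (σ : GalQ) (P : E.GeomPoint) (i : Fin 3) :
    (E.galAct σ P).coords i = σ (P.coords i) := by
  cases P with
  | zero =>
    change (![0, 1, 0] : Fin 3 → Qbar) i = σ ((![0, 1, 0] : Fin 3 → Qbar) i)
    fin_cases i <;> simp
  | some x y h =>
    change (![σ x, σ y, 1] : Fin 3 → Qbar) i = σ ((![x, y, 1] : Fin 3 → Qbar) i)
    fin_cases i <;> simp

lemma aeval_coords_galAct (σ : GalQ) (P : E.GeomPoint) (F : MvPolynomial (Fin 3) ℚ) :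
    MvPolynomial.aeval (E.galAct σ P).coords F = σ (MvPolynomial.aeval P.coords F) := by
  have h : (E.galAct σ P).coords = fun i => σ (P.coords i) :=
    funext (GeomPoint.coords_galAct σ P)
  rw [h]
  exact (MvPolynomial.comp_aeval_apply P.coords σ.toAlgHom F).symm

/-- The coordinates are normalised, so proportionality forces equality; u = 0 is impossible because
no coordinate vector vanishes. -/
lemma GeomPoint.eq_of_coords_eq_mul {P Q : E.GeomPoint} {u : Qbar}
    (h : ∀ i, P.coords i = u * Q.coords i) : P = Q := by
  have h0 := h 0
  have h1 := h 1
  have h2 := h 2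
  cases P <;> cases Q <;> simp only [GeomPoint.coords, Matrix.cons_val] at h0 h1 h2
  · rfl
  · simp only [mul_one] at h2
    simp [← h2] at h1
  · simp at h2
  · simp only [mul_one] at h2
    subst h2
    simp only [one_mul] at h0 h1
    subst h0 h1
    rfl

/-- An isogeny defined over `ℚ` commutes with the Galois action. -/
theorem RatIsogeny.map_galAct (φ : E.RatIsogeny E') (σ : GalQ) (P : E.GeomPoint) :
    φ.toHom (E.galAct σ P) = E'.galAct σ (φ.toHom P) := by
  obtain ⟨d, F, -, ⟨i, hi⟩, hF⟩ := φ.isMorphism P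
  obtain ⟨u, hu, hP⟩ := hF P ⟨i, hi⟩
  obtain ⟨v, hv, hσ⟩ := hF (E.galAct σ P) ⟨i, by
    rw [aeval_coords_galAct]
    exact (map_ne_zero σ).mpr hi⟩
  -- F has rational coefficients, so F(σP) = σ(F(P)); the left side is v · φ(σP) and the right side
  -- is σ(u) · σ(φ(P)).
  refine GeomPoint.eq_of_coords_eq_mul (u := v⁻¹ * σ u) fun j => ?_
  rw [GeomPoint.coords_galAct, mul_assoc, ← map_mul, ← hP, ← aeval_coords_galAct, hσ,
    inv_mul_cancel_left₀ hv]

lemma galAct_eq_of_mem_rationalPoints (σ : GalQ) {P : E.GeomPoint} (hP : P ∈ E.rationalPoints) :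
    E.galAct σ P = P := by
  obtain ⟨R, rfl⟩ := hP
  rw [galAct, Affine.Point.map_map]
  exact congrArg (fun f => Affine.Point.map (W' := E) f R)
    (Subsingleton.elim (σ.toAlgHom.comp (Algebra.ofId ℚ Qbar)) (Algebra.ofId ℚ Qbar))

/-- The reverse inclusion comes from applying the hypothesis to σ⁻¹. -/
lemma isRationalSubgroup_zmultiples {R : E.GeomPoint}
    (h : ∀ σ, E.galAct σ R ∈ AddSubgroup.zmultiples R) :
    E.IsRationalSubgroup (AddSubgroup.zmultiples R) := by
  intro σ
  rw [AddMonoidHom.map_zmultiples]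
  refine le_antisymm (by rw [AddSubgroup.zmultiples_le]; exact h σ) ?_
  rw [AddSubgroup.zmultiples_le]
  obtain ⟨k, hk⟩ := AddSubgroup.mem_zmultiples_iff.mp (h σ⁻¹)
  refine AddSubgroup.mem_zmultiples_iff.mpr ⟨k, ?_⟩
  rw [← map_zsmul, hk, ← galAct_mul, mul_inv_cancel, galAct_one]

lemma IsRationalSubgroup.galAct_mem {H : AddSubgroup E.GeomPoint} (h : E.IsRationalSubgroup H)
    (σ : GalQ) {R : E.GeomPoint} (hR : R ∈ H) : E.galAct σ R ∈ H := by
  have := AddSubgroup.mem_map_of_mem (E.galAct σ) hR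
  rwa [h σ] at this

lemma coe_intCast_smul {n : ℕ} (a : ℤ) (x : E.nTorsion n) :
    (((a : ZMod n) • x : E.nTorsion n) : E.GeomPoint) = a • (x : E.GeomPoint) := by
  rw [Int.cast_smul_eq_zsmul, AddSubgroup.coe_zsmul]

instance isElliptic_baseChange_Qbar [E.IsElliptic] :
    WeierstrassCurve.IsElliptic (Affine.baseChange E Qbar) :=
  inferInstanceAs (E.map (algebraMap ℚ Qbar)).IsElliptic

/-- A basis of `E[2 ^ (k + 1)]` made of two points whose multiples by `2 ^ k` are independent. -/
theorem exists_basis_nTorsion [E.IsElliptic] {k n : ℕ} (hn : 2 ^ (k + 1) = n) {P Q : E.GeomPoint}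
    (h : IndepTwoTorsion (2 ^ k • P) (2 ^ k • Q)) :
    ∃ b : Module.Basis (Fin 2) (ZMod n) (E.nTorsion n),
      (b 0 : E.GeomPoint) = P ∧ (b 1 : E.GeomPoint) = Q := by
  have hP : P ∈ E.nTorsion n := by
    rw [AddSubgroup.torsionBy.nsmul_iff, ← hn, pow_succ, mul_nsmul]
    exact h.left
  have hQ : Q ∈ E.nTorsion n := by
    rw [AddSubgroup.torsionBy.nsmul_iff, ← hn, pow_succ, mul_nsmul]
    exact h.right
  have hli : LinearIndependent (ZMod n) ![(⟨P, hP⟩ : E.nTorsion n), ⟨Q, hQ⟩] := by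
    rw [LinearIndependent.pair_iff]
    intro s t hst
    obtain ⟨a, rfl⟩ := ZMod.intCast_surjective s
    obtain ⟨b, rfl⟩ := ZMod.intCast_surjective t
    have hst' := congrArg (Subtype.val) hst
    rw [AddSubgroup.coe_add, coe_intCast_smul, coe_intCast_smul] at hst'
    rw [ZMod.intCast_zmod_eq_zero_iff_dvd, ZMod.intCast_zmod_eq_zero_iff_dvd, ← hn]
    exact_mod_cast h.dvd_of_zsmul_add_zsmul_eq_zero hst'
  have hsp : ⊤ ≤ Submodule.span (ZMod n)
      (Set.range ![(⟨P, hP⟩ : E.nTorsion n), ⟨Q, hQ⟩]) := by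
    rintro ⟨R, hR⟩ -
    rw [AddSubgroup.torsionBy.nsmul_iff, ← hn] at hR
    obtain ⟨a, b, hab⟩ := h.exists_zsmul_add_zsmul_eq Affine.Point.ncard_two_torsion hR
    rw [Matrix.range_cons, Matrix.range_cons, Matrix.range_empty, Set.union_empty,
      Set.singleton_union, Submodule.mem_span_pair]
    refine ⟨a, b, Subtype.ext ?_⟩
    rw [AddSubgroup.coe_add, coe_intCast_smul, coe_intCast_smul]
    exact hab.symm
  exact ⟨Module.Basis.mk hli hsp, by simp, by simp⟩

variable {n : ℕ}

lemma coe_galRep (σ : GalQ) (x : E.nTorsion n) :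
    (E.galRep n σ x : E.GeomPoint) = E.galAct σ x := rfl

lemma coe_modRep (b : Module.Basis (Fin 2) (ZMod n) (E.nTorsion n)) (σ : GalQ) :
    (E.modRep b σ : Matrix (Fin 2) (Fin 2) (ZMod n)) = LinearMap.toMatrix b b (E.galRep n σ) := rfl

/-- The matrix of `σ` in the basis `{P, Q}` is read off from `σ(P)` and `σ(Q)`. -/
theorem coe_modRep_eq_iff (b : Module.Basis (Fin 2) (ZMod n) (E.nTorsion n)) (σ : GalQ)
    (A B C D : ℤ) :
    (E.modRep b σ : Matrix (Fin 2) (Fin 2) (ZMod n)) =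
        (!![A, C; B, D] : Matrix (Fin 2) (Fin 2) ℤ).map (Int.cast : ℤ → ZMod n) ↔
      E.galAct σ (b 0) = A • (b 0 : E.GeomPoint) + B • (b 1 : E.GeomPoint) ∧
      E.galAct σ (b 1) = C • (b 0 : E.GeomPoint) + D • (b 1 : E.GeomPoint) := by
  rw [coe_modRep, ← LinearEquiv.eq_symm_apply, LinearMap.toMatrix_symm]
  have key : ∀ f g : Module.End (ZMod n) (E.nTorsion n), f = g ↔ f (b 0) = g (b 0) ∧
      f (b 1) = g (b 1) := fun f g => by
    constructor
    · rintro rfl; exact ⟨rfl, rfl⟩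
    · rintro ⟨h0, h1⟩
      refine b.ext fun i => ?_
      fin_cases i
      exacts [h0, h1]
  rw [key, Matrix.toLin_self, Matrix.toLin_self, Subtype.ext_iff, Subtype.ext_iff, coe_galRep,
    coe_galRep]
  simp [Fin.sum_univ_two, coe_intCast_smul]

lemma modRep_eq_modRep_iff (b : Module.Basis (Fin 2) (ZMod n) (E.nTorsion n)) (σ τ : GalQ) :
    E.modRep b σ = E.modRep b τ ↔ ∀ P ∈ E.nTorsion n, E.galAct σ P = E.galAct τ P := by
  rw [Units.ext_iff, coe_modRep, coe_modRep, (LinearMap.toMatrix b b).injective.eq_iff]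
  constructor
  · intro h P hP
    have := congrArg Subtype.val (LinearMap.congr_fun h ⟨P, hP⟩)
    exact this
  · intro h
    exact LinearMap.ext fun P => Subtype.ext (h P P.2)

/-- Generators of the image of one representation give generators of the image of another one that
factors through it. -/
theorem isGeneratedByMod_modImage_of_factors {m s : ℕ}
    {b : Module.Basis (Fin 2) (ZMod n) (E.nTorsion n)}
    {b' : Module.Basis (Fin 2) (ZMod m) (E'.nTorsion m)}
    {M M' : Fin s → Matrix (Fin 2) (Fin 2) ℤ} (h : IsGeneratedByMod n M (E.modImage b))
    (hM : ∀ i σ, (E.modRep b σ : Matrix (Fin 2) (Fin 2) (ZMod n)) = (M i).map Int.cast →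
      (E'.modRep b' σ : Matrix (Fin 2) (Fin 2) (ZMod m)) = (M' i).map Int.cast)
    (hker : ∀ σ τ, E.modRep b σ = E.modRep b τ → E'.modRep b' σ = E'.modRep b' τ) :
    IsGeneratedByMod m M' (E'.modImage b') := by
  obtain ⟨g, hg, hH⟩ := h
  have hmem : ∀ i, g i ∈ E.modImage b := fun i => by
    rw [hH]; exact Subgroup.subset_closure ⟨i, rfl⟩
  choose σ hσ using hmem
  refine ⟨fun i => E'.modRep b' (σ i), fun i => hM i (σ i) (by rw [hσ, hg]), ?_⟩
  have hcl : ∀ {G : Type} [Group G] (f : GalQ →* G),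
      Subgroup.closure (Set.range fun i => f (σ i)) =
        (Subgroup.closure (Set.range σ)).map f := fun f => by
    rw [MonoidHom.map_closure, ← Set.range_comp]; rfl
  have hg' : g = fun i => E.modRep b (σ i) := funext fun i => (hσ i).symm
  rw [hg', hcl] at hH
  rw [hcl]
  -- The chosen σ i need not generate the Galois group, but each τ agrees on E[n] with some ρ in the
  -- subgroup they generate, and `hker` carries this over to E'.
  refine le_antisymm ?_ (Subgroup.map_le_range _ _)
  rintro _ ⟨τ, rfl⟩
  have hτ : E.modRep b τ ∈ E.modImage b := ⟨τ, rfl⟩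
  rw [hH] at hτ
  obtain ⟨ρ, hρ, hρτ⟩ := hτ
  exact ⟨ρ, hρ, hker ρ τ hρτ⟩

/-- Changing the basis of `E[n]` conjugates the image of the mod-`n` representation. -/
theorem ModImageConjTo.of_basis {s : ℕ} {M : Fin s → Matrix (Fin 2) (Fin 2) ℤ}
    (b : Module.Basis (Fin 2) (ZMod n) (E.nTorsion n))
    (h : IsGeneratedByMod n M (E.modImage b)) : E.ModImageConjTo n M := by
  refine ⟨⟨b⟩, fun b' => ⟨E.modImage b, ?_⟩⟩
  let g : GL (Fin 2) (ZMod n) :=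
    ⟨b'.toMatrix b, b.toMatrix b', b'.toMatrix_mul_toMatrix_flip b,
      b.toMatrix_mul_toMatrix_flip b'⟩
  refine ⟨g, h, ?_⟩
  have hconj : (MulAut.conj g).toMonoidHom.comp (E.modRep b) = E.modRep b' := by
    ext1 σ
    refine Units.ext ?_
    change b'.toMatrix b * LinearMap.toMatrix b b (E.galRep n σ) * b.toMatrix b' =
      LinearMap.toMatrix b' b' (E.galRep n σ)
    exact basis_toMatrix_mul_linearMap_toMatrix_mul_basis_toMatrix b' b b' b _
  rw [modImage, modImage, ← hconj, MonoidHom.range_comp]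

end WeierstrassCurve

/-- Every subgroup of `GL(2, ℤ/nℤ)` is generated by finitely many integer matrices. -/
theorem exists_isGeneratedByMod (n : ℕ) [NeZero n] (H : Subgroup (GL (Fin 2) (ZMod n))) :
    ∃ (s : ℕ) (A B C D : Fin s → ℤ), IsGeneratedByMod n (fun i => !![A i, C i; B i, D i]) H := by
  obtain ⟨s, ⟨e⟩⟩ := Finite.exists_equiv_fin H
  let g : Fin s → GL (Fin 2) (ZMod n) := fun i => e.symm i
  have hcast (i : Fin s) (j k : Fin 2) : ((((g i) j k).val : ℤ) : ZMod n) = (g i) j k := by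
    simp
  refine ⟨s, fun i => (g i 0 0).val, fun i => (g i 1 0).val, fun i => (g i 0 1).val,
    fun i => (g i 1 1).val, g, fun i => ?_, ?_⟩
  · ext j k
    fin_cases j <;> fin_cases k <;> simp
  · have : Set.range g = H := by
      change Set.range (Subtype.val ∘ e.symm) = _
      rw [EquivLike.range_comp, Subtype.range_coe]
    rw [this, Subgroup.closure_eq]

end

/-! ### Quotients by cyclic subgroups of order four -/

namespace WeierstrassCurve

variable {E E' : WeierstrassCurve ℚ}

/-- The points `4P` and `cP + Q` of a basis `{P, Q}` of `E[128]` map to independent points under an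
isogeny with kernel generated by `32(cP + Q)`. -/
lemma RatIsogeny.indepTwoTorsion (φ : E.RatIsogeny E') {P Q : E.GeomPoint}
    (h : IndepTwoTorsion (2 ^ 6 • P) (2 ^ 6 • Q)) (c : ℤ)
    (hker : φ.toHom.ker = AddSubgroup.zmultiples (32 • (c • P + Q))) :
    IndepTwoTorsion (2 ^ 4 • φ.toHom (4 • P)) (2 ^ 4 • φ.toHom (c • P + Q)) := by
  have hmem : ∀ x y : ℤ, φ.toHom (x • P + y • Q) = 0 →
      ∃ k : ℤ, (128 : ℤ) ∣ x - k * 32 * c ∧ (128 : ℤ) ∣ y - k * 32 := by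
    intro x y hxy
    rw [← AddMonoidHom.mem_ker, hker] at hxy
    obtain ⟨k, hk⟩ := AddSubgroup.mem_zmultiples_iff.mp hxy
    refine ⟨k, h.dvd_of_zsmul_add_zsmul_eq_zero ?_⟩
    rw [sub_smul, sub_smul, sub_add_sub_comm, ← hk]
    module
  -- The points 64P, 16(cP + Q) and their difference must avoid the kernel. Kernel elements have
  -- Q-coefficient divisible by 32, which excludes ±16; Q-coefficient 0 modulo 128 forces 4 ∣ k,
  -- hence P-coefficient 0 modulo 128, which excludes 64.
  have h64 : φ.toHom ((64 : ℤ) • P + (0 : ℤ) • Q) ≠ 0 := fun H => by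
    obtain ⟨k, hk, hk'⟩ := hmem _ _ H
    obtain ⟨m, rfl⟩ : (4 : ℤ) ∣ k := by omega
    obtain ⟨a, ha⟩ := hk
    have : (64 : ℤ) = 128 * (a + m * c) := by linear_combination ha
    omega
  have h16 : φ.toHom ((16 * c) • P + (16 : ℤ) • Q) ≠ 0 := fun H => by
    obtain ⟨k, -, hk⟩ := hmem _ _ H
    omega
  have h48 : φ.toHom ((64 - 16 * c) • P + (-16 : ℤ) • Q) ≠ 0 := fun H => by
    obtain ⟨k, -, hk⟩ := hmem _ _ H
    omega
  have hz : φ.toHom (32 • (c • P + Q)) = 0 := by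
    rw [← AddMonoidHom.mem_ker, hker]
    exact AddSubgroup.mem_zmultiples _
  refine ⟨?_, ?_, fun H => h64 ?_, fun H => h16 ?_, fun H => h48 ?_⟩
  · rw [← map_nsmul, ← map_nsmul, ← map_zero φ.toHom, ← h.left]
    congr 1
  · rw [← map_nsmul, ← map_nsmul, ← hz]
    congr 1
  · rw [← map_nsmul] at H
    rw [← H]
    congr 1
    module
  · rw [← map_nsmul] at H
    rw [← H]
    congr 1
    module
  · rw [← map_nsmul, ← map_nsmul, ← sub_eq_zero, ← map_sub] at H
    rw [← H]
    congr 1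
    module

/-- The image of the mod-`32` representation of the quotient by `⟨32(cP + Q)⟩`, in terms of the image
of the mod-`128` representation in the basis `{P, Q}`. -/
theorem RatIsogeny.modImageConjTo [E'.IsElliptic] (φ : E.RatIsogeny E')
    (b : Module.Basis (Fin 2) (ZMod 128) (E.nTorsion 128))
    (h : IndepTwoTorsion (2 ^ 6 • (b 0 : E.GeomPoint)) (2 ^ 6 • (b 1 : E.GeomPoint))) (c : ℤ)
    (hker : φ.toHom.ker =
      AddSubgroup.zmultiples (32 • (c • (b 0 : E.GeomPoint) + (b 1 : E.GeomPoint))))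
    {s : ℕ} {A B C D : Fin s → ℤ}
    (hgen : IsGeneratedByMod 128 (fun i => !![A i, C i; B i, D i]) (E.modImage b))
    (hdvd : ∀ i, 4 ∣ c * A i + C i - c ^ 2 * B i - c * D i) :
    E'.ModImageConjTo 32 (fun i => !![A i - c * B i,
      (c * A i + C i - c ^ 2 * B i - c * D i) / 4; 4 * B i, c * B i + D i]) := by
  obtain ⟨b', h0, h1⟩ := exists_basis_nTorsion (n := 32) (by norm_num)
    (φ.indepTwoTorsion h c hker)
  refine .of_basis b' <| isGeneratedByMod_modImage_of_factors hgen (fun i σ hσ => ?_) ?_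
  · rw [coe_modRep_eq_iff] at hσ ⊢
    obtain ⟨hP, hQ⟩ := hσ
    obtain ⟨t, ht⟩ := hdvd i
    simp only [ht]
    rw [Int.mul_ediv_cancel_left _ four_ne_zero]
    have hCi : C i = 4 * t - c * A i + c ^ 2 * B i + c * D i := by
      linear_combination ht
    rw [hCi] at hQ
    rw [h0, h1, ← φ.map_galAct, ← φ.map_galAct]
    simp only [map_add, map_nsmul, map_zsmul, hP, hQ]
    -- These are σ(4P) = (A − cB)(4P) + 4B(cP + Q) and σ(cP + Q) = t(4P) + (cB + D)(cP + Q), pushed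
    -- through φ.
    exact ⟨by module, by module⟩
  · intro σ τ hστ
    rw [modRep_eq_modRep_iff] at hστ
    refine Units.ext ?_
    rw [coe_modRep, coe_modRep]
    congr 1
    refine b'.ext fun i => Subtype.ext ?_
    rw [coe_galRep, coe_galRep]
    have hb (j : Fin 2) := hστ (b j) (b j).2
    fin_cases i
    · change E'.galAct σ (b' 0) = E'.galAct τ (b' 0)
      rw [h0, ← φ.map_galAct, ← φ.map_galAct, map_nsmul (E.galAct σ), map_nsmul (E.galAct τ), hb]
    · change E'.galAct σ (b' 1) = E'.galAct τ (b' 1)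
      rw [h1, ← φ.map_galAct, ← φ.map_galAct, map_add (E.galAct σ), map_add (E.galAct τ),
        map_zsmul (E.galAct σ), map_zsmul (E.galAct τ), hb, hb]

/-- A basis `{P, Q}` of `E[128]` with `32Q` a prescribed point of order four. -/
lemma exists_basis_of_addOrderOf_eq_four [E.IsElliptic] {R : E.GeomPoint}
    (hR : addOrderOf R = 4) :
    ∃ b : Module.Basis (Fin 2) (ZMod 128) (E.nTorsion 128),
      IndepTwoTorsion (2 ^ 6 • (b 0 : E.GeomPoint)) (2 ^ 6 • (b 1 : E.GeomPoint)) ∧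
      32 • (b 1 : E.GeomPoint) = R := by
  have hR4 : 4 • R = 0 := hR ▸ addOrderOf_nsmul_eq_zero R
  have hR2 : 2 • R ≠ 0 := fun H => by
    have := addOrderOf_dvd_of_nsmul_eq_zero H
    rw [hR] at this
    omega
  obtain ⟨Q, hQ⟩ := exists_pow_two_nsmul_eq Affine.Point.exists_two_nsmul_eq 5 R
  -- T is a point of order two outside ⟨R⟩; it becomes 64P.
  obtain ⟨T, hT, hT'⟩ : ∃ T ∈ {T : E.GeomPoint | 2 • T = 0}, T ∉ ({0, 2 • R} : Set E.GeomPoint) :=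
    Set.exists_mem_notMem_of_ncard_lt_ncard <| by
      rw [Affine.Point.ncard_two_torsion]
      exact (Set.ncard_insert_le _ _).trans_lt (by rw [Set.ncard_singleton]; norm_num)
  obtain ⟨P, hP⟩ := exists_pow_two_nsmul_eq Affine.Point.exists_two_nsmul_eq 6 T
  rw [Set.mem_insert_iff, Set.mem_singleton_iff, not_or] at hT'
  have hQ' : 2 ^ 6 • Q = 2 • R := by rw [← hQ, ← mul_nsmul]; norm_num
  have h : IndepTwoTorsion (2 ^ 6 • P) (2 ^ 6 • Q) := by
    rw [hP, hQ']
    exact ⟨hT, by rw [← mul_nsmul]; exact hR4, hT'.1, hR2, hT'.2⟩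
  obtain ⟨b, h0, h1⟩ := exists_basis_nTorsion (n := 128) (by norm_num) h
  exact ⟨b, by rwa [h0, h1], by rw [h1, ← hQ]; norm_num⟩

/-- Congruences for the matrix of `σ` in a basis `{P, Q}` of `E[128]`, when `E[2]` is fixed by `σ`
and `⟨32Q⟩` is stable. -/
lemma dvd_of_galAct_eq {P Q : E.GeomPoint} (h : IndepTwoTorsion (2 ^ 6 • P) (2 ^ 6 • Q))
    {σ : GalQ} (hP : E.galAct σ (2 ^ 6 • P) = 2 ^ 6 • P) (hQ : E.galAct σ (2 ^ 6 • Q) = 2 ^ 6 • Q)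
    (hQ' : E.galAct σ (32 • Q) ∈ AddSubgroup.zmultiples (32 • Q)) {A B C D : ℤ}
    (hA : E.galAct σ P = A • P + B • Q) (hC : E.galAct σ Q = C • P + D • Q) :
    Odd A ∧ Odd D ∧ 2 ∣ B ∧ 4 ∣ C := by
  obtain ⟨k, hk⟩ := AddSubgroup.mem_zmultiples_iff.mp hQ'
  rw [map_nsmul, hA] at hP
  rw [map_nsmul, hC] at hQ hk
  -- Comparing coefficients modulo 128: fixing 64P and 64Q gives the parities, and 32C ≡ 0 from
  -- stability of ⟨32Q⟩ gives 4 ∣ C.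
  have h1 := h.dvd_of_zsmul_add_zsmul_eq_zero (a := 64 * (A - 1)) (b := 64 * B) (by
    rw [← sub_eq_zero.mpr hP]; module)
  have h2 := h.dvd_of_zsmul_add_zsmul_eq_zero (a := 64 * C) (b := 64 * (D - 1)) (by
    rw [← sub_eq_zero.mpr hQ]; module)
  have h3 := h.dvd_of_zsmul_add_zsmul_eq_zero (a := 32 * C) (b := 32 * D - 32 * k) (by
    rw [← sub_eq_zero.mpr hk.symm]; module)
  norm_num at h1 h2 h3
  rw [Int.odd_iff, Int.odd_iff]
  omega

/-- Adding a fixed point of order two, not a multiple of it, to a point of order four that generates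
a rational subgroup gives another such point. -/
lemma isRationalSubgroup_add {T R : E.GeomPoint} (hR : addOrderOf R = 4) (hT : 2 • T = 0)
    (hR2 : ∀ σ, E.galAct σ (2 • R) = 2 • R) (hTσ : ∀ σ, E.galAct σ T = T)
    (hrat : E.IsRationalSubgroup (AddSubgroup.zmultiples R)) :
    addOrderOf (T + R) = 4 ∧ E.IsRationalSubgroup (AddSubgroup.zmultiples (T + R)) := by
  have hR4 : 4 • R = 0 := hR ▸ addOrderOf_nsmul_eq_zero R
  constructor
  · refine addOrderOf_eq_prime_pow (p := 2) (n := 1) ?_ ?_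
    · rw [pow_one, nsmul_add, hT, zero_add]
      intro H
      have := addOrderOf_dvd_of_nsmul_eq_zero H
      rw [hR] at this
      omega
    · rw [show 2 ^ (1 + 1) = 2 * 2 by norm_num, nsmul_add, mul_nsmul T, hT, nsmul_zero, zero_add]
      exact hR4
  · refine isRationalSubgroup_zmultiples fun σ => ?_
    obtain ⟨k, hk⟩ := AddSubgroup.mem_zmultiples_iff.mp
      (hrat.galAct_mem σ (AddSubgroup.mem_zmultiples R))
    have h2 := hR2 σ
    rw [map_nsmul, ← hk] at h2
    -- Since 2R is fixed, 2k ≡ 2 modulo 4, so k is odd and kT = T; hence σ(T + R) = k(T + R).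
    have hdvd : (addOrderOf R : ℤ) ∣ 2 * k - 2 := by
      rw [addOrderOf_dvd_iff_zsmul_eq_zero, ← sub_eq_zero.mpr h2]
      module
    rw [hR] at hdvd
    refine AddSubgroup.mem_zmultiples_iff.mpr ⟨k, ?_⟩
    rw [map_add, hTσ, zsmul_add, hk]
    congr 1
    rcases zsmul_eq_zero_or_of_two_nsmul hT k with ⟨⟨j, rfl⟩, -⟩ | ⟨-, h⟩
    · push_cast at hdvd
      omega
    · exact h

end WeierstrassCurve

theorem mainTheorem6 (E : WeierstrassCurve ℚ) [E.IsElliptic]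
    (h2 : E.HasFullRationalTwoTorsion)
    (Q₄ : E.GeomPoint) (hQ₄ : addOrderOf Q₄ = 4)
    (hrat : E.IsRationalSubgroup (AddSubgroup.zmultiples Q₄)) :
    ∃ b : Module.Basis (Fin 2) (ZMod 128) (E.nTorsion 128),
      32 • (b 1 : E.GeomPoint) = Q₄ ∧
      (∃ (s : ℕ) (A B C D : Fin s → ℤ),
        IsGeneratedByMod 128 (fun i => !![A i, C i; B i, D i]) (E.modImage b)) ∧
      (addOrderOf (64 • (b 0 : E.GeomPoint) + Q₄) = 4 ∧
        E.IsRationalSubgroup (AddSubgroup.zmultiples (64 • (b 0 : E.GeomPoint) + Q₄))) ∧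
      ∀ (s : ℕ) (A B C D : Fin s → ℤ),
        IsGeneratedByMod 128 (fun i => !![A i, C i; B i, D i]) (E.modImage b) →
        (∀ i, Odd (A i) ∧ Odd (D i) ∧ 2 ∣ B i ∧ 4 ∣ C i) ∧
        (∀ (E' : WeierstrassCurve ℚ) [E'.IsElliptic] (φ : E.RatIsogeny E'),
          φ.toHom.ker = AddSubgroup.zmultiples Q₄ →
          E'.ModImageConjTo 32 (fun i => !![A i, C i / 4; 4 * B i, D i])) ∧
        (∀ i, 4 ∣ 2 * A i + C i - 4 * B i - 2 * D i) ∧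
        (∀ (E' : WeierstrassCurve ℚ) [E'.IsElliptic] (φ : E.RatIsogeny E'),
          φ.toHom.ker = AddSubgroup.zmultiples (64 • (b 0 : E.GeomPoint) + Q₄) →
          E'.ModImageConjTo 32 (fun i =>
            !![A i - 2 * B i, (2 * A i + C i - 4 * B i - 2 * D i) / 4;
               4 * B i, 2 * B i + D i])) := by
  obtain ⟨b, h, hb⟩ := WeierstrassCurve.exists_basis_of_addOrderOf_eq_four hQ₄
  have hfix (P : E.GeomPoint) (hP : 2 • P = 0) (σ : GalQ) : E.galAct σ P = P :=
    WeierstrassCurve.galAct_eq_of_mem_rationalPoints σ (h2 P hP)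
  refine ⟨b, hb, exists_isGeneratedByMod 128 _,
    WeierstrassCurve.isRationalSubgroup_add hQ₄ h.left (fun σ => hfix _ ?_ σ)
      (hfix _ h.left) hrat, fun s A B C D hgen => ?_⟩
  · rw [← mul_nsmul, show 2 * 2 = addOrderOf Q₄ from hQ₄.symm, addOrderOf_nsmul_eq_zero]
  have hcong (i : Fin s) : Odd (A i) ∧ Odd (D i) ∧ 2 ∣ B i ∧ 4 ∣ C i := by
    obtain ⟨g, hg, hH⟩ := hgen
    obtain ⟨σ, hσ⟩ : g i ∈ E.modImage b := by
      rw [hH]; exact Subgroup.subset_closure ⟨i, rfl⟩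
    obtain ⟨hA, hC⟩ := (WeierstrassCurve.coe_modRep_eq_iff b σ _ _ _ _).mp
      ((congrArg Units.val hσ).trans (hg i))
    exact WeierstrassCurve.dvd_of_galAct_eq h (hfix _ h.left σ) (hfix _ h.right σ)
      (by rw [hb]; exact hrat.galAct_mem σ (AddSubgroup.mem_zmultiples _)) hA hC
  have hdvd (i : Fin s) : 4 ∣ 2 * A i + C i - 4 * B i - 2 * D i := by
    obtain ⟨h1, h2, -, h3⟩ := hcong i
    rw [Int.odd_iff] at h1 h2
    omega
  refine ⟨hcong, fun E' _ φ hφ => ?_, hdvd, fun E' _ φ hφ => ?_⟩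
  · simpa using φ.modImageConjTo b h 0 (by rw [zero_zsmul, zero_add, hb, hφ]) hgen
      fun i => by simpa using (hcong i).2.2.2
  -- Here c = 2, because 64P + 32Q = 32(2P + Q).
  · refine φ.modImageConjTo b h 2 ?_ hgen hdvd
    rw [hφ, ← hb]
    congr 1
    module
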